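/- Let $q$ be a natural number and let $F$ be a real-valued function on the symmetric positive definite $q\times q$ real matrices which is orthogonally invariant, i.e. $F(H\Sigma H^{\mathrm T})=F(\Sigma)$ for every positive definite $\Sigma$ and every orthogonal $H$. Then there is a unique symmetric (i.e. permutation invariant) function $f:\mathbb R^q\to\mathbb R$ with $F(\Sigma)=f(\log\lambda_1,\dots,\log\lambda_q)$ for every positive definite $\Sigma$, where $\lambda_1\ge\cdots\ge\lambda_q>0$ are the eigenvalues of $\Sigma$ counted with multiplicity. For this $f$ the following three conditions are equivalent: (i) $F$ is g-convex: for all positive definite $\Sigma_0,\Sigma_1$ and $0<t<1$, $F(\Sigma_t)\le(1-t)F(\Sigma_0)+tF(\Sigma_1)$, where $\Sigma_t=\Sigma_0^{1/2}\{\Sigma_0^{-1/2}\Sigma_1\Sigma_0^{-1/2}\}^t\Sigma_0^{1/2}$; (ii) $F(\Sigma)$ is convex in $\log\Sigma$: the function $A\mapsto F(e^A)$ is convex on the space of real symmetric $q\times q$ matrices; (iii) $f$ is convex on $\mathbb R^q$. Likewise, the following three conditions are equivalent: (i') $F$ is strictly g-convex, i.e. $F(\Sigma_t)<(1-t)F(\Sigma_0)+tF(\Sigma_1)$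 for all positive definite $\Sigma_0\ne\Sigma_1$ and $0<t<1$; (ii') $A\mapsto F(e^A)$ is strictly convex on the space of real symmetric $q\times q$ matrices; (iii') $f$ is strictly convex on $\mathbb R^q$. -/

import Mathlib

open Matrix

noncomputable section

/-- The real power `A ^ t` of a symmetric (positive definite) matrix `A`: the function `x ↦ x ^ t` is
applied to the eigenvalues of `A`, keeping the eigenvectors. -/
def symmPow {q : ℕ} (A : Matrix (Fin q) (Fin q) ℝ) (t : ℝ) : Matrix (Fin q) (Fin q) ℝ :=
  cfc (fun x : ℝ => x ^ t) A

/-- The geodesic path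
`S_t = S₀^{1/2} (S₀^{-1/2} S₁ S₀^{-1/2})^t S₀^{1/2}` between positive definite matrices. -/
def geodesic {q : ℕ} (S₀ S₁ : Matrix (Fin q) (Fin q) ℝ) (t : ℝ) : Matrix (Fin q) (Fin q) ℝ :=
  symmPow S₀ (1 / 2) *
    symmPow (symmPow S₀ (-(1 / 2)) * S₁ * symmPow S₀ (-(1 / 2))) t *
    symmPow S₀ (1 / 2)

/-- Geodesic convexity of a function on the positive definite matrices of order `q`.  Only the values
of `F` at positive definite matrices are involved. -/
def GConvex {q : ℕ} (F : Matrix (Fin q) (Fin q) ℝ → ℝ) : Prop :=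
  ∀ S₀ S₁ : Matrix (Fin q) (Fin q) ℝ, S₀.PosDef → S₁.PosDef → ∀ t : ℝ, 0 < t → t < 1 →
    F (geodesic S₀ S₁ t) ≤ (1 - t) * F S₀ + t * F S₁

/-- Strict geodesic convexity. -/
def StrictGConvex {q : ℕ} (F : Matrix (Fin q) (Fin q) ℝ → ℝ) : Prop :=
  ∀ S₀ S₁ : Matrix (Fin q) (Fin q) ℝ, S₀.PosDef → S₁.PosDef → S₀ ≠ S₁ →
    ∀ t : ℝ, 0 < t → t < 1 → F (geodesic S₀ S₁ t) < (1 - t) * F S₀ + t * F S₁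

/-- `F(S)` is convex in `log S`: the function `A ↦ F(e^A)` is convex on the real vector space of
symmetric matrices. -/
def ConvexInLog {q : ℕ} (F : Matrix (Fin q) (Fin q) ℝ → ℝ) : Prop :=
  ConvexOn ℝ {A : Matrix (Fin q) (Fin q) ℝ | A.IsSymm} (fun A => F (NormedSpace.exp A))

/-- `F(S)` is strictly convex in `log S`. -/
def StrictConvexInLog {q : ℕ} (F : Matrix (Fin q) (Fin q) ℝ → ℝ) : Prop :=
  StrictConvexOn ℝ {A : Matrix (Fin q) (Fin q) ℝ | A.IsSymm} (fun A => F (NormedSpace.exp A))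

/-- Orthogonal invariance on the positive definite matrices: `F(S) = F(H S Hᵀ)` for all orthogonal
`H`. -/
def OrthogonallyInvariant {q : ℕ} (F : Matrix (Fin q) (Fin q) ℝ → ℝ) : Prop :=
  ∀ S : Matrix (Fin q) (Fin q) ℝ, S.PosDef → ∀ H ∈ Matrix.orthogonalGroup (Fin q) ℝ,
    F (H * S * Hᵀ) = F S

/-- The eigenvalues, with multiplicity, of a symmetric matrix in decreasing order
`λ_1 ≥ ⋯ ≥ λ_q`. -/
def orderedEigenvalues {q : ℕ} {S : Matrix (Fin q) (Fin q) ℝ} (hS : S.IsHermitian) : Fin q → ℝ :=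
  fun i => hS.eigenvalues₀ (Fin.cast (Fintype.card_fin q).symm i)

/-- `f` is a function on `ℝ^q` corresponding to `F`: it is symmetric (permutation invariant) and
`F(S) = f(log λ_1, …, log λ_q)` for all positive definite `S`. -/
def IsCorresponding {q : ℕ} (F : Matrix (Fin q) (Fin q) ℝ → ℝ) (f : (Fin q → ℝ) → ℝ) : Prop :=
  (∀ (σ : Equiv.Perm (Fin q)) (a : Fin q → ℝ), f (a ∘ σ) = f a) ∧
    ∀ (S : Matrix (Fin q) (Fin q) ℝ) (hS : S.PosDef),
      F S = f (fun i => Real.log (orderedEigenvalues hS.isHermitian i))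

end

/-! The only candidate is `f a = F (diagonal (exp a))`. On diagonal matrices both the geodesics and
the lines in `log S` are segments in the exponents, so either convexity of `F` restricts to
convexity of `f`.

The converse rests on majorization: a symmetric convex `f` does not increase when its argument moves
into the convex hull of the rearrangements of a vector. For geodesics,
`log_eigenvalues_geodesic_mem_convexHull` puts the log-eigenvalues of `S_t` in the hull for `(1 - t)
x + t y`, where `x`, `y` are the sorted log-eigenvalues of the end points; it comes from
log-convexity of minors (Cauchy–Binet and Hölder). For `log S`, Schur's theorem is applied in an
eigenbasis of the convex combination.

Strictness needs the equality cases: trace is strictly convex along geodesics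
(`eq_of_trace_geodesic_eq`), and a symmetric matrix whose diagonal is its spectrum is diagonal
(`conj_diagonal_eq_diagonal_of_diag_eq`). -/

/-! ### Majorization and symmetric convex functions -/

/-- Abel summation: lowering the common coefficient from `c (last n)` to `m` only raises the bound,
as it multiplies a nonpositive total. A free lower bound `m` lets the induction start at `n = 0`. -/
theorem sum_mul_le_of_partial_sums_nonpos {n : ℕ} (c x : Fin n → ℝ) (hc : Antitone c)
    (hx : ∀ (k : ℕ) (h : k ≤ n), ∑ i : Fin k, x (Fin.castLE h i) ≤ 0)
    (m : ℝ) (hm : ∀ i, m ≤ c i) : ∑ i, c i * x i ≤ m * ∑ i, x i := by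
  induction n generalizing m with
  | zero => simp
  | succ n ih =>
    have h1 := ih (fun i => c i.castSucc) (fun i => x i.castSucc)
      (fun i j hij => hc (by simpa using hij)) (fun k h => hx k (h.trans n.le_succ))
      (c (Fin.last n)) (fun i => hc (Fin.le_last _))
    have h2 : ∑ i, x i ≤ 0 := hx (n + 1) le_rfl
    have h3 := hm (Fin.last n)
    rw [Fin.sum_univ_castSucc] at h2 ⊢
    rw [Fin.sum_univ_castSucc (f := x)]
    nlinarith

/-- A vector majorized by `b` lies in the convex hull of the rearrangements of `b`. -/
theorem mem_convexHull_perm_of_majorized {q : ℕ} (a b : Fin q → ℝ)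
    (h : ∀ (τ : Equiv.Perm (Fin q)) (k : ℕ) (hk : k ≤ q),
      ∑ i : Fin k, a (τ (Fin.castLE hk i)) ≤ ∑ i : Fin k, b (Fin.castLE hk i))
    (htot : ∑ i, a i = ∑ i, b i) :
    a ∈ convexHull ℝ (Set.range fun σ : Equiv.Perm (Fin q) => b ∘ σ) := by
  by_contra hn
  obtain ⟨φ, u, h1, h2⟩ := geometric_hahn_banach_closed_point (convex_convexHull ℝ _)
    ((Set.finite_range fun σ : Equiv.Perm (Fin q) => b ∘ σ).isClosed_convexHull ℝ) hn
  have hφ (y : Fin q → ℝ) : φ y = ∑ i, y i * φ (Pi.single i 1) := by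
    conv_lhs => rw [pi_eq_sum_univ' y, map_sum]
    refine Finset.sum_congr rfl fun i _ => ?_
    rw [map_smul, smul_eq_mul]
  set c : Fin q → ℝ := fun i => φ (Pi.single i 1) with hc
  -- Sorting the coefficients of the separating functional decreasingly singles out `b ∘ τ.symm`,
  -- which pairs `b i` with the `i`-th largest one; Abel summation then contradicts separation.
  set τ := Tuple.sort (-c)
  have hanti : Antitone (c ∘ τ) := fun i j hij => by
    have := Tuple.monotone_sort (-c) hij
    simpa using this
  have h3 := h1 (b ∘ τ.symm) (subset_convexHull ℝ _ ⟨τ.symm, rfl⟩)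
  -- Any lower bound will do: by `htot` it is multiplied by zero.
  obtain ⟨m, hm⟩ := (Set.finite_range (c ∘ τ)).bddBelow
  have h4 := sum_mul_le_of_partial_sums_nonpos (c ∘ τ) (fun i => a (τ i) - b i) hanti
    (fun k hk => by simpa using h τ k hk) m (fun i => hm ⟨i, rfl⟩)
  rw [Finset.sum_sub_distrib, Equiv.sum_comp τ a, htot, sub_self, mul_zero] at h4
  have h5 : φ a = ∑ i, a (τ i) * c (τ i) := by
    rw [hφ, Equiv.sum_comp τ (fun i => a i * c i)]
  have h6 : φ (b ∘ τ.symm) = ∑ i, b i * c (τ i) := by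
    rw [hφ, ← Equiv.sum_comp τ]; simp [hc]
  have h7 : ∑ i, (c ∘ τ) i * (a (τ i) - b i) = φ a - φ (b ∘ τ.symm) := by
    rw [h5, h6, ← Finset.sum_sub_distrib]
    exact Finset.sum_congr rfl fun i _ => by simp; ring
  linarith

theorem ConvexOn.le_of_mem_convexHull_perm {q : ℕ} {f : (Fin q → ℝ) → ℝ}
    (hf : ConvexOn ℝ Set.univ f) (hs : ∀ (σ : Equiv.Perm (Fin q)) a, f (a ∘ σ) = f a)
    {a b : Fin q → ℝ} (h : a ∈ convexHull ℝ (Set.range fun σ : Equiv.Perm (Fin q) => b ∘ σ)) :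
    f a ≤ f b := by
  obtain ⟨y, ⟨σ, rfl⟩, hy⟩ := hf.exists_ge_of_mem_convexHull (Set.subset_univ _) h
  exact hy.trans (hs σ b).le

/-- Strict Jensen: a point of nonzero weight differs from the mean, because the mean is not a
rearrangement of `b`. -/
theorem StrictConvexOn.lt_of_mem_convexHull_perm {q : ℕ} {f : (Fin q → ℝ) → ℝ}
    (hf : StrictConvexOn ℝ Set.univ f) (hs : ∀ (σ : Equiv.Perm (Fin q)) a, f (a ∘ σ) = f a)
    {a b : Fin q → ℝ} (h : a ∈ convexHull ℝ (Set.range fun σ : Equiv.Perm (Fin q) => b ∘ σ))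
    (hne : ∀ σ : Equiv.Perm (Fin q), a ≠ b ∘ σ) : f a < f b := by
  rw [convexHull_range_eq_exists_affineCombination] at h
  obtain ⟨s, w, hw0, hw1, rfl⟩ := h
  rw [Finset.affineCombination_eq_linear_combination _ _ _ hw1] at hne ⊢
  have hj : ∃ j ∈ s, w j ≠ 0 := by
    by_contra! hz
    rw [Finset.sum_eq_zero hz] at hw1
    exact zero_ne_one hw1
  obtain ⟨j, hj, hwj⟩ := hj
  have := (hf.map_sum_lt_iff_of_nonneg' hw0 hw1 (p := fun σ : Equiv.Perm (Fin q) => b ∘ σ)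
    (by simp)).2 ⟨j, hj, hwj, (hne j).symm⟩
  simpa [hs, ← Finset.sum_mul, hw1] using this

/-! ### Cauchy–Binet, summed over all index maps -/

namespace Matrix

variable {q : ℕ}

/-- A symmetrized form of the Cauchy–Binet formula. -/
theorem factorial_mul_det_transpose_mul_diagonal_mul {n : Type*} [Fintype n] [DecidableEq n]
    {k : ℕ} (Y : Matrix n (Fin k) ℝ) (d : n → ℝ) :
    (k.factorial : ℝ) * (Yᵀ * diagonal d * Y).det =
      ∑ p : Fin k → n, (∏ i, d (p i)) * (Y.submatrix p id).det ^ 2 := by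
  have h1 : (Yᵀ * diagonal d * Y).det =
      ∑ p : Fin k → n, (∏ i, Y (p i) i) * (∏ i, d (p i)) * (Y.submatrix p id).det := by
    have : (Yᵀ * diagonal d * Y) = fun i => ∑ j, (Y j i * d j) • Y j := by
      ext i l
      simp [Matrix.mul_apply (M := _ * _), Finset.sum_apply, mul_diagonal]
    rw [this]
    refine (MultilinearMap.map_sum
      (detRowAlternating (R := ℝ) (n := Fin k)).toMultilinearMap _).trans ?_
    refine Finset.sum_congr rfl fun p _ => ?_
    refine (MultilinearMap.map_smul_univ
      (detRowAlternating (R := ℝ) (n := Fin k)).toMultilinearMap _ _).trans ?_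
    rw [Finset.prod_mul_distrib, smul_eq_mul]
    rfl
  -- Reindexing by `p ∘ σ` changes the minor by `sign σ`; summing over `σ` rebuilds a second copy of
  -- the minor and produces `k!` on the left.
  have h2 (σ : Equiv.Perm (Fin k)) : (Yᵀ * diagonal d * Y).det =
      ∑ p : Fin k → n, ((Equiv.Perm.sign σ : ℤ) : ℝ) * (∏ i, Y (p (σ i)) i) * (∏ i, d (p i)) *
        (Y.submatrix p id).det := by
    rw [h1, ← Equiv.sum_comp (Equiv.arrowCongr σ.symm (Equiv.refl n))]
    refine Finset.sum_congr rfl fun p _ => ?_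
    have e1 : ∏ i, d (p (σ i)) = ∏ i, d (p i) := Equiv.prod_comp σ (fun i => d (p i))
    have e2 : (Y.submatrix (p ∘ σ) id).det =
        ((Equiv.Perm.sign σ : ℤ) : ℝ) * (Y.submatrix p id).det :=
      det_permute σ (Y.submatrix p id)
    have e3 : (Equiv.arrowCongr σ.symm (Equiv.refl n)) p = p ∘ σ := rfl
    rw [e3, e2]
    simp only [Function.comp_apply, e1]
    ring
  have h3 := Finset.sum_congr rfl fun σ (_ : σ ∈ (Finset.univ : Finset (Equiv.Perm (Fin k)))) =>
    h2 σ
  rw [Finset.sum_const, Finset.card_univ, Fintype.card_perm, Fintype.card_fin, nsmul_eq_mul,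
    Finset.sum_comm] at h3
  rw [h3]
  refine Finset.sum_congr rfl fun p _ => ?_
  simp_rw [← Finset.sum_mul]
  have : (Y.submatrix p id).det =
      ∑ σ : Equiv.Perm (Fin k), ((Equiv.Perm.sign σ : ℤ) : ℝ) * ∏ i, Y (p (σ i)) i :=
    det_apply' _
  rw [← this]
  ring

end Matrix

/-! ### Orthogonal diagonalization and geodesics in congruence coordinates -/

namespace Matrix

variable {q : ℕ}

theorem transpose_mul_self_of_mem_orthogonalGroup {V : Matrix (Fin q) (Fin q) ℝ}
    (hV : V ∈ orthogonalGroup (Fin q) ℝ) : Vᵀ * V = 1 := by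
  simpa [star_eq_conjTranspose] using (mem_orthogonalGroup_iff' (Fin q) ℝ).1 hV

theorem mul_transpose_self_of_mem_orthogonalGroup {V : Matrix (Fin q) (Fin q) ℝ}
    (hV : V ∈ orthogonalGroup (Fin q) ℝ) : V * Vᵀ = 1 := by
  simpa [star_eq_conjTranspose] using (mem_orthogonalGroup_iff (Fin q) ℝ).1 hV

theorem transpose_mem_orthogonalGroup {V : Matrix (Fin q) (Fin q) ℝ}
    (hV : V ∈ orthogonalGroup (Fin q) ℝ) : Vᵀ ∈ orthogonalGroup (Fin q) ℝ := by
  rw [mem_orthogonalGroup_iff]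
  exact transpose_mul_self_of_mem_orthogonalGroup hV

theorem submatrix_one_perm_mem_orthogonalGroup (σ : Equiv.Perm (Fin q)) :
    (1 : Matrix (Fin q) (Fin q) ℝ).submatrix σ id ∈ orthogonalGroup (Fin q) ℝ := by
  rw [mem_orthogonalGroup_iff]
  change _ * ((1 : Matrix (Fin q) (Fin q) ℝ).submatrix σ id)ᵀ = 1
  ext i j
  simp [Matrix.mul_apply, Matrix.one_apply]

theorem conj_diagonal_perm (σ : Equiv.Perm (Fin q)) (d : Fin q → ℝ) :
    (1 : Matrix (Fin q) (Fin q) ℝ).submatrix σ id * diagonal d *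
      ((1 : Matrix (Fin q) (Fin q) ℝ).submatrix σ id)ᵀ = diagonal (d ∘ σ) := by
  ext i j
  rw [Matrix.mul_apply]
  simp only [mul_diagonal, submatrix_apply, id_eq, one_apply, transpose_apply, mul_ite, mul_one,
    mul_zero, ite_mul, one_mul, zero_mul, Finset.sum_ite_eq, Finset.mem_univ, if_true,
    diagonal_apply, EmbeddingLike.apply_eq_iff_eq, Function.comp_apply]
  split_ifs <;> simp_all

theorem IsHermitian.exists_orthogonal_conj_eigenvalues {S : Matrix (Fin q) (Fin q) ℝ}
    (hS : S.IsHermitian) :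
    ∃ V ∈ orthogonalGroup (Fin q) ℝ, S = V * diagonal hS.eigenvalues * Vᵀ := by
  refine ⟨hS.eigenvectorUnitary, hS.eigenvectorUnitary.2, ?_⟩
  conv_lhs => rw [hS.spectral_theorem, Unitary.conjStarAlgAut_apply]
  rfl

theorem roots_charpoly_conj_diagonal {V : Matrix (Fin q) (Fin q) ℝ}
    (hV : V ∈ orthogonalGroup (Fin q) ℝ) (d : Fin q → ℝ) :
    (V * diagonal d * Vᵀ).charpoly.roots = Multiset.map d Finset.univ.val := by
  rw [charpoly_mul_comm, ← mul_assoc, transpose_mul_self_of_mem_orthogonalGroup hV, one_mul,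
    charpoly_diagonal, Polynomial.roots_prod]
  · simp
  · simp [Finset.prod_ne_zero_iff, Polynomial.X_sub_C_ne_zero]

theorem exists_perm_of_map_univ_eq {α : Type*} [LinearOrder α] {d e : Fin q → α}
    (h : Multiset.map d Finset.univ.val = Multiset.map e Finset.univ.val) :
    ∃ σ : Equiv.Perm (Fin q), d = e ∘ σ := by
  rw [Fin.univ_val_map, Fin.univ_val_map, Multiset.coe_eq_coe] at h
  have h1 : d ∘ Tuple.sort d = e ∘ Tuple.sort e := List.ofFn_injective <|
    List.Perm.eq_of_sortedLE (Tuple.monotone_sort d).sortedLE_ofFn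
      (Tuple.monotone_sort e).sortedLE_ofFn
      ((Equiv.Perm.ofFn_comp_perm _ _).trans (h.trans (Equiv.Perm.ofFn_comp_perm _ _).symm))
  refine ⟨(Tuple.sort d).symm.trans (Tuple.sort e), ?_⟩
  ext i
  simpa using congrFun h1 ((Tuple.sort d).symm i)

/-- Both diagonals list the roots of one characteristic polynomial. -/
theorem exists_perm_of_conj_diagonal_eq {V W : Matrix (Fin q) (Fin q) ℝ}
    (hV : V ∈ orthogonalGroup (Fin q) ℝ) (hW : W ∈ orthogonalGroup (Fin q) ℝ)
    {d e : Fin q → ℝ} (h : V * diagonal d * Vᵀ = W * diagonal e * Wᵀ) :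
    ∃ σ : Equiv.Perm (Fin q), d = e ∘ σ := by
  have h1 := roots_charpoly_conj_diagonal hV d
  rw [h, roots_charpoly_conj_diagonal hW e] at h1
  exact exists_perm_of_map_univ_eq h1.symm

theorem exists_perm_orderedEigenvalues {S : Matrix (Fin q) (Fin q) ℝ} (hS : S.IsHermitian) :
    ∃ σ : Equiv.Perm (Fin q), orderedEigenvalues hS = hS.eigenvalues ∘ σ := by
  refine ⟨(finCongr (Fintype.card_fin q).symm).trans
    (Fintype.equivOfCardEq (Fintype.card_fin _)), ?_⟩
  ext i
  simp [orderedEigenvalues, IsHermitian.eigenvalues]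

theorem antitone_orderedEigenvalues {S : Matrix (Fin q) (Fin q) ℝ} (hS : S.IsHermitian) :
    Antitone (orderedEigenvalues hS) := fun _ _ hij =>
  hS.eigenvalues₀_antitone (by simpa using hij)

/-- The spectral theorem, with the eigenvalues in decreasing order. -/
theorem IsHermitian.exists_orthogonal_conj_orderedEigenvalues {S : Matrix (Fin q) (Fin q) ℝ}
    (hS : S.IsHermitian) :
    ∃ V ∈ orthogonalGroup (Fin q) ℝ, S = V * diagonal (orderedEigenvalues hS) * Vᵀ := by
  obtain ⟨V, hV, h⟩ := hS.exists_orthogonal_conj_eigenvalues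
  obtain ⟨σ, hσ⟩ := exists_perm_orderedEigenvalues hS
  set P := (1 : Matrix (Fin q) (Fin q) ℝ).submatrix σ id with hP
  have hPo : P ∈ orthogonalGroup (Fin q) ℝ := submatrix_one_perm_mem_orthogonalGroup σ
  refine ⟨V * Pᵀ, mul_mem hV (transpose_mem_orthogonalGroup hPo), ?_⟩
  have hPP := transpose_mul_self_of_mem_orthogonalGroup hPo
  rw [hσ, ← conj_diagonal_perm, ← hP, transpose_mul, transpose_transpose]
  calc S = V * 1 * diagonal hS.eigenvalues * 1 * Vᵀ := by simpa using h
    _ = _ := by rw [← hPP]; noncomm_ring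

theorem orderedEigenvalues_pos {S : Matrix (Fin q) (Fin q) ℝ} (hS : S.PosDef) (i : Fin q) :
    0 < orderedEigenvalues hS.isHermitian i := by
  obtain ⟨σ, hσ⟩ := exists_perm_orderedEigenvalues hS.isHermitian
  rw [hσ]
  exact hS.eigenvalues_pos _

theorem posDef_conj_diagonal {X : Matrix (Fin q) (Fin q) ℝ} (hX : IsUnit X)
    {d : Fin q → ℝ} (hd : ∀ i, 0 < d i) : (X * diagonal d * Xᵀ).PosDef := by
  have := (PosDef.diagonal hd).mul_mul_conjTranspose_same (B := X)
    (Matrix.vecMul_injective_iff_isUnit.2 hX)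
  simpa using this

theorem isUnit_of_mem_orthogonalGroup {V : Matrix (Fin q) (Fin q) ℝ}
    (hV : V ∈ orthogonalGroup (Fin q) ℝ) : IsUnit V :=
  IsUnit.of_mul_eq_one _ (mul_transpose_self_of_mem_orthogonalGroup hV)

/-- A positive definite matrix is an orthogonal conjugate of the exponential of a decreasing
diagonal. -/
theorem PosDef.exists_orthogonal_conj_exp {S : Matrix (Fin q) (Fin q) ℝ} (hS : S.PosDef) :
    ∃ V ∈ orthogonalGroup (Fin q) ℝ, ∃ a : Fin q → ℝ, Antitone a ∧
      S = V * diagonal (fun i => Real.exp (a i)) * Vᵀ := by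
  obtain ⟨V, hV, h⟩ := hS.isHermitian.exists_orthogonal_conj_orderedEigenvalues
  refine ⟨V, hV, fun i => Real.log (orderedEigenvalues hS.isHermitian i), fun i j hij =>
    Real.log_le_log (orderedEigenvalues_pos hS _) (antitone_orderedEigenvalues _ hij), ?_⟩
  simpa [Real.exp_log (orderedEigenvalues_pos hS _)] using h

/-- The change of basis `Vᵀ * U` intertwines the two diagonals, so its `(i, j)` entry vanishes
unless `d i = l j`; hence it also intertwines their images under `g`. -/
theorem cfc_conj_diagonal {V : Matrix (Fin q) (Fin q) ℝ} (hV : V ∈ orthogonalGroup (Fin q) ℝ)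
    (d : Fin q → ℝ) (g : ℝ → ℝ) :
    cfc g (V * diagonal d * Vᵀ) = V * diagonal (fun i => g (d i)) * Vᵀ := by
  have hA : (V * diagonal d * Vᵀ).IsHermitian := by
    simp [IsHermitian, conjTranspose_eq_transpose_of_trivial, transpose_mul, mul_assoc]
  rw [hA.cfc_eq, IsHermitian.cfc, Unitary.conjStarAlgAut_apply]
  have h := hA.spectral_theorem
  rw [Unitary.conjStarAlgAut_apply] at h
  set U : Matrix (Fin q) (Fin q) ℝ := hA.eigenvectorUnitary.1
  have hUm : U ∈ orthogonalGroup (Fin q) ℝ := hA.eigenvectorUnitary.2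
  set l := hA.eigenvalues
  have e1 := transpose_mul_self_of_mem_orthogonalGroup hV
  have e2 := mul_transpose_self_of_mem_orthogonalGroup hV
  have e3 := transpose_mul_self_of_mem_orthogonalGroup hUm
  have e4 := mul_transpose_self_of_mem_orthogonalGroup hUm
  change _ = U * diagonal l * Uᵀ at h
  change U * diagonal (fun i => g (l i)) * Uᵀ = _
  have hM : diagonal d * (Vᵀ * U) = (Vᵀ * U) * diagonal l := by
    calc diagonal d * (Vᵀ * U) = (Vᵀ * V) * diagonal d * (Vᵀ * U) := by rw [e1, one_mul]
      _ = Vᵀ * (V * diagonal d * Vᵀ) * U := by noncomm_ring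
      _ = Vᵀ * U * diagonal l * (Uᵀ * U) := by rw [h]; noncomm_ring
      _ = _ := by rw [e3, mul_one]
  have hM' : diagonal (fun i => g (d i)) * (Vᵀ * U) =
      (Vᵀ * U) * diagonal (fun i => g (l i)) := by
    ext i j
    have := congrFun (congrFun hM i) j
    rw [diagonal_mul, mul_diagonal] at this ⊢
    by_cases h0 : (Vᵀ * U) i j = 0
    · simp [h0]
    · rw [mul_comm] at this
      rw [mul_left_cancel₀ h0 this, mul_comm]
  calc U * diagonal (fun i => g (l i)) * Uᵀ
      = (V * Vᵀ) * U * diagonal (fun i => g (l i)) * Uᵀ := by rw [e2, one_mul]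
    _ = V * ((Vᵀ * U) * diagonal (fun i => g (l i))) * Uᵀ := by noncomm_ring
    _ = V * diagonal (fun i => g (d i)) * Vᵀ * (U * Uᵀ) := by rw [← hM']; noncomm_ring
    _ = _ := by rw [e4, mul_one]

theorem exp_conj_diagonal {V : Matrix (Fin q) (Fin q) ℝ} (hV : V ∈ orthogonalGroup (Fin q) ℝ)
    (d : Fin q → ℝ) :
    NormedSpace.exp (V * diagonal d * Vᵀ) = V * diagonal (fun i => Real.exp (d i)) * Vᵀ := by
  have : Vᵀ = V⁻¹ := (inv_eq_right_inv (mul_transpose_self_of_mem_orthogonalGroup hV)).symm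
  rw [this, exp_conj _ _ (isUnit_of_mem_orthogonalGroup hV), exp_diagonal]
  congr 3
  ext i
  rw [Pi.coe_exp, Real.exp_eq_exp_ℝ]

/-- Two positive definite matrices are simultaneously diagonalized by congruence, and their geodesic
is then diagonal as well. -/
theorem exists_congruence_geodesic {S₀ S₁ : Matrix (Fin q) (Fin q) ℝ} (h₀ : S₀.PosDef)
    (h₁ : S₁.PosDef) :
    ∃ (X : Matrix (Fin q) (Fin q) ℝ) (d : Fin q → ℝ), IsUnit X ∧ (∀ i, 0 < d i) ∧
      S₀ = X * Xᵀ ∧ S₁ = X * diagonal d * Xᵀ ∧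
      ∀ t, geodesic S₀ S₁ t = X * diagonal (fun i => d i ^ t) * Xᵀ := by
  obtain ⟨V, hV, a, -, hS₀⟩ := h₀.exists_orthogonal_conj_exp
  have e1 := transpose_mul_self_of_mem_orthogonalGroup hV
  have e2 := mul_transpose_self_of_mem_orthogonalGroup hV
  set A := symmPow S₀ (1 / 2) with hA
  set B := symmPow S₀ (-(1 / 2)) with hB
  have hA' : A = V * diagonal (fun i => Real.exp (a i) ^ (1 / 2 : ℝ)) * Vᵀ := by
    rw [hA, symmPow, hS₀, cfc_conj_diagonal hV]
  have hB' : B = V * diagonal (fun i => Real.exp (a i) ^ (-(1 / 2) : ℝ)) * Vᵀ := by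
    rw [hB, symmPow, hS₀, cfc_conj_diagonal hV]
  have hAA : A * A = S₀ := by
    calc A * A = V * diagonal (fun i => Real.exp (a i) ^ (1 / 2 : ℝ)) * (Vᵀ * V) *
          diagonal (fun i => Real.exp (a i) ^ (1 / 2 : ℝ)) * Vᵀ := by rw [hA']; noncomm_ring
      _ = S₀ := by
        rw [e1, mul_one, mul_assoc V, diagonal_mul_diagonal, hS₀]
        simp_rw [← Real.rpow_add (Real.exp_pos _)]
        norm_num
  have hAB : A * B = 1 := by
    calc A * B = V * diagonal (fun i => Real.exp (a i) ^ (1 / 2 : ℝ)) * (Vᵀ * V) *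
          diagonal (fun i => Real.exp (a i) ^ (-(1 / 2) : ℝ)) * Vᵀ := by
            rw [hA', hB']; noncomm_ring
      _ = 1 := by
        rw [e1, mul_one, mul_assoc V, diagonal_mul_diagonal]
        simp_rw [← Real.rpow_add (Real.exp_pos _)]
        simp [e2]
  have hBA : B * A = 1 := mul_eq_one_comm.1 hAB
  have hAt : Aᵀ = A := by rw [hA']; simp [transpose_mul, mul_assoc]
  have hBt : Bᵀ = B := by rw [hB']; simp [transpose_mul, mul_assoc]
  have hC : (B * S₁ * B).PosDef := by
    have := h₁.mul_mul_conjTranspose_same (B := B)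
      (Matrix.vecMul_injective_iff_isUnit.2 (IsUnit.of_mul_eq_one _ hBA))
    simpa [hBt] using this
  obtain ⟨W, hW, c, -, hCW⟩ := hC.exists_orthogonal_conj_exp
  -- Here `X = S₀^{1/2} W`, with `W` diagonalizing `S₀^{-1/2} S₁ S₀^{-1/2}` and `d` its eigenvalues.
  refine ⟨A * W, fun i => Real.exp (c i), (IsUnit.of_mul_eq_one _ hAB).mul
    (isUnit_of_mem_orthogonalGroup hW), fun i => Real.exp_pos _, ?_, ?_, fun t => ?_⟩
  · rw [transpose_mul, hAt]
    calc S₀ = A * 1 * A := by rw [mul_one, hAA]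
      _ = _ := by rw [← mul_transpose_self_of_mem_orthogonalGroup hW]; noncomm_ring
  · rw [transpose_mul, hAt]
    calc S₁ = (A * B) * S₁ * (B * A) := by rw [hAB, hBA, one_mul, mul_one]
      _ = A * (B * S₁ * B) * A := by noncomm_ring
      _ = _ := by rw [hCW]; noncomm_ring
  · rw [transpose_mul, hAt, geodesic, ← hA, ← hB, hCW, symmPow, cfc_conj_diagonal hW]
    noncomm_ring

end Matrix

/-! ### Log-convexity of minors and majorization along geodesics -/

/-- Hölder with exponents `1 / (1 - t)` and `1 / t`, applied to `c ^ (1 - t)` and `(r * c) ^ t`. -/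
theorem sum_mul_rpow_le_geom {ι : Type*} (s : Finset ι) (c r : ι → ℝ) (hc : ∀ i ∈ s, 0 ≤ c i)
    (hr : ∀ i ∈ s, 0 ≤ r i) {t : ℝ} (h0 : 0 < t) (h1 : t < 1) :
    ∑ i ∈ s, r i ^ t * c i ≤ (∑ i ∈ s, c i) ^ (1 - t) * (∑ i ∈ s, r i * c i) ^ t := by
  have h1' : 0 < 1 - t := sub_pos.2 h1
  have hpq : (1 - t)⁻¹.HolderConjugate t⁻¹ := by
    rw [Real.holderConjugate_iff]
    exact ⟨(one_lt_inv₀ h1').2 (by linarith), by simp⟩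
  have := Real.inner_le_Lp_mul_Lq_of_nonneg s hpq (f := fun i => c i ^ (1 - t))
    (g := fun i => (r i * c i) ^ t) (fun i hi => Real.rpow_nonneg (hc i hi) _)
    (fun i hi => Real.rpow_nonneg (mul_nonneg (hr i hi) (hc i hi)) _)
  simp only [one_div, inv_inv] at this
  convert this using 2 with i hi
  · rw [Real.mul_rpow (hr i hi) (hc i hi), mul_left_comm,
      ← Real.rpow_add_of_nonneg (hc i hi) h1'.le h0.le]
    simp
  · congr 1
    refine Finset.sum_congr rfl fun i hi => ?_
    rw [← Real.rpow_mul (hc i hi), mul_inv_cancel₀ h1'.ne', Real.rpow_one]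
  · congr 1
    refine Finset.sum_congr rfl fun i hi => ?_
    rw [← Real.rpow_mul (mul_nonneg (hr i hi) (hc i hi)), mul_inv_cancel₀ h0.ne', Real.rpow_one]

theorem Antitone.sum_comp_injective_le {q k : ℕ} {b : Fin q → ℝ} (hb : Antitone b) (hk : k ≤ q)
    {p : Fin k → Fin q} (hp : Function.Injective p) :
    ∑ i, b (p i) ≤ ∑ i : Fin k, b (Fin.castLE hk i) := by
  rw [← Equiv.sum_comp (Tuple.sort p)]
  have hm : StrictMono (p ∘ Tuple.sort p) :=
    (Tuple.monotone_sort p).strictMono_of_injective (hp.comp (Tuple.sort p).injective)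
  -- A strictly increasing sequence of naturals has `n`-th term at least `n`.
  have key : ∀ (n : ℕ) (h : n < k), n ≤ ((p ∘ Tuple.sort p) ⟨n, h⟩ : ℕ) := by
    intro n
    induction n with
    | zero => simp
    | succ n ih =>
      intro h
      have := ih (by omega)
      have h2 : (p ∘ Tuple.sort p) ⟨n, by omega⟩ < (p ∘ Tuple.sort p) ⟨n + 1, h⟩ :=
        hm (by simp)
      have h3 : ((p ∘ Tuple.sort p) ⟨n, by omega⟩ : ℕ) < ((p ∘ Tuple.sort p) ⟨n + 1, h⟩ : ℕ) := h2
      omega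
  exact Finset.sum_le_sum fun i _ => hb (Fin.le_def.2 (key i i.2))

namespace Matrix

variable {q k : ℕ}

theorem det_transpose_mul_diagonal_mul_nonneg (Y : Matrix (Fin q) (Fin k) ℝ) {d : Fin q → ℝ}
    (hd : ∀ i, 0 ≤ d i) : 0 ≤ (Yᵀ * diagonal d * Y).det := by
  have h := factorial_mul_det_transpose_mul_diagonal_mul Y d
  have h2 : 0 ≤ ∑ p : Fin k → Fin q, (∏ i, d (p i)) * (Y.submatrix p id).det ^ 2 :=
    Finset.sum_nonneg fun p _ => mul_nonneg (Finset.prod_nonneg fun i _ => hd _) (sq_nonneg _)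
  rw [← h] at h2
  exact nonneg_of_mul_nonneg_right h2 (by positivity)

/-- Minors are log-convex along `t ↦ diagonal (d ^ t)`. -/
theorem det_transpose_mul_diagonal_rpow_mul_le (Y : Matrix (Fin q) (Fin k) ℝ) {d : Fin q → ℝ}
    (hd : ∀ i, 0 < d i) {t : ℝ} (h0 : 0 < t) (h1 : t < 1) :
    (Yᵀ * diagonal (fun i => d i ^ t) * Y).det ≤
      (Yᵀ * Y).det ^ (1 - t) * (Yᵀ * diagonal d * Y).det ^ t := by
  have e0 := factorial_mul_det_transpose_mul_diagonal_mul Y (fun _ => 1)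
  have e1 := factorial_mul_det_transpose_mul_diagonal_mul Y d
  have et := factorial_mul_det_transpose_mul_diagonal_mul Y (fun i => d i ^ t)
  have n0 := det_transpose_mul_diagonal_mul_nonneg Y (d := fun _ => 1) (fun _ => zero_le_one)
  have n1 := det_transpose_mul_diagonal_mul_nonneg Y (fun i => (hd i).le)
  simp only [diagonal_one, Matrix.mul_one, Finset.prod_const_one, one_mul] at e0 n0
  -- By Cauchy–Binet the three determinants are, up to `k!`, the sums of `r_p ^ s * c_p` at `s = 0,
  -- 1, t`, with squared minors as weights `c_p`.
  have h := sum_mul_rpow_le_geom Finset.univ (fun p : Fin k → Fin q => (Y.submatrix p id).det ^ 2)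
    (fun p => ∏ i, d (p i)) (fun p _ => sq_nonneg _)
    (fun p _ => Finset.prod_nonneg fun i _ => (hd _).le) h0 h1
  simp_rw [← Real.finsetProd_rpow _ _ (fun i _ => (hd _).le)] at h
  have hk : (0 : ℝ) < k.factorial := by positivity
  rw [← e0, ← e1, ← et, Real.mul_rpow hk.le n0, Real.mul_rpow hk.le n1] at h
  have hkk : (k.factorial : ℝ) ^ (1 - t) * (k.factorial : ℝ) ^ t = k.factorial := by
    rw [← Real.rpow_add hk]; simp
  refine le_of_mul_le_mul_left (h.trans_eq ?_) hk
  rw [mul_mul_mul_comm, hkk]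

/-- The product of the `k` largest eigenvalues bounds the minors with respect to orthonormal
`k`-frames. -/
theorem det_transpose_mul_diagonal_exp_mul_le (hk : k ≤ q) (Y : Matrix (Fin q) (Fin k) ℝ)
    (hY : Yᵀ * Y = 1) {b : Fin q → ℝ} (hb : Antitone b) :
    (Yᵀ * diagonal (fun i => Real.exp (b i)) * Y).det ≤
      Real.exp (∑ i : Fin k, b (Fin.castLE hk i)) := by
  -- Orthonormality makes the squared minors sum to `k!`, so the determinant is a weighted average
  -- of products of the `exp (b (p i))`; non-injective `p` have weight zero.
  have e0 := factorial_mul_det_transpose_mul_diagonal_mul Y (fun _ => 1)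
  simp only [diagonal_one, Matrix.mul_one, Finset.prod_const_one, one_mul, hY, det_one,
    mul_one] at e0
  have hkp : (0 : ℝ) < k.factorial := by positivity
  refine le_of_mul_le_mul_left ?_ hkp
  rw [factorial_mul_det_transpose_mul_diagonal_mul, e0, Finset.sum_mul]
  refine Finset.sum_le_sum fun p _ => ?_
  rw [mul_comm]
  by_cases hp : Function.Injective p
  · refine mul_le_mul_of_nonneg_left ?_ (sq_nonneg _)
    rw [← Real.exp_sum]
    exact Real.exp_le_exp.2 (hb.sum_comp_injective_le hk hp)
  · obtain ⟨i, j, hij, hne⟩ := Function.not_injective_iff.1 hp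
    have : (Y.submatrix p id).det = 0 := det_zero_of_row_eq hne (by ext l; simp [hij])
    simp [this]

theorem transpose_submatrix_mul_diagonal_mul_submatrix (d : Fin q → ℝ) {e : Fin k → Fin q}
    (he : Function.Injective e) :
    ((1 : Matrix (Fin q) (Fin q) ℝ).submatrix id e)ᵀ * diagonal d *
      (1 : Matrix (Fin q) (Fin q) ℝ).submatrix id e = diagonal (fun i => d (e i)) := by
  ext i j
  rw [Matrix.mul_apply]
  simp only [mul_diagonal, submatrix_apply, id_eq, one_apply, transpose_apply, mul_ite, mul_one,
    mul_zero, ite_mul, one_mul, zero_mul, Finset.sum_ite_eq', Finset.mem_univ, if_true,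
    diagonal_apply, he.eq_iff]
  split_ifs <;> simp_all

theorem det_conj_diagonal_exp {V : Matrix (Fin q) (Fin q) ℝ} (hV : V ∈ orthogonalGroup (Fin q) ℝ)
    (a : Fin q → ℝ) :
    (V * diagonal (fun i => Real.exp (a i)) * Vᵀ).det = Real.exp (∑ i, a i) := by
  rw [det_mul_comm, ← mul_assoc, transpose_mul_self_of_mem_orthogonalGroup hV, one_mul,
    det_diagonal, Real.exp_sum]

/-- The logarithms of the eigenvalues of a geodesic are majorized by the corresponding combination
of those of the end points. -/
theorem log_eigenvalues_geodesic_mem_convexHull {V₀ V₁ Q : Matrix (Fin q) (Fin q) ℝ}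
    (hV₀ : V₀ ∈ orthogonalGroup (Fin q) ℝ) (hV₁ : V₁ ∈ orthogonalGroup (Fin q) ℝ)
    (hQ : Q ∈ orthogonalGroup (Fin q) ℝ) {x y a : Fin q → ℝ} (hx : Antitone x) (hy : Antitone y)
    {S₀ S₁ : Matrix (Fin q) (Fin q) ℝ} (h₀ : S₀.PosDef) (h₁ : S₁.PosDef)
    (hS₀ : S₀ = V₀ * diagonal (fun i => Real.exp (x i)) * V₀ᵀ)
    (hS₁ : S₁ = V₁ * diagonal (fun i => Real.exp (y i)) * V₁ᵀ) {t : ℝ} (ht0 : 0 < t) (ht1 : t < 1)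
    (ha : geodesic S₀ S₁ t = Q * diagonal (fun i => Real.exp (a i)) * Qᵀ) :
    a ∈ convexHull ℝ (Set.range fun σ : Equiv.Perm (Fin q) => ((1 - t) • x + t • y) ∘ σ) := by
  obtain ⟨X, d, hX, hd, hX₀, hX₁, hXt⟩ := exists_congruence_geodesic h₀ h₁
  refine mem_convexHull_perm_of_majorized _ _ (fun τ k hk => ?_) ?_
  -- `Q * J` is an orthonormal frame of `k` eigenvectors of the geodesic point, so compressing to it
  -- gives determinant `exp (∑ a (e i))`.
  · set e : Fin k → Fin q := fun i => τ (Fin.castLE hk i) with he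
    have hei : Function.Injective e := τ.injective.comp (Fin.castLE_injective hk)
    set J : Matrix (Fin q) (Fin k) ℝ := (1 : Matrix (Fin q) (Fin q) ℝ).submatrix id e with hJ
    have hJJ : Jᵀ * J = 1 := by
      have := transpose_submatrix_mul_diagonal_mul_submatrix (fun _ => 1) hei
      rwa [diagonal_one, Matrix.mul_one] at this
    have hQQ := transpose_mul_self_of_mem_orthogonalGroup hQ
    have bound {V : Matrix (Fin q) (Fin q) ℝ} (hV : V ∈ orthogonalGroup (Fin q) ℝ)
        {z : Fin q → ℝ} (hz : Antitone z) :
        (Jᵀ * Qᵀ * (V * diagonal (fun i => Real.exp (z i)) * Vᵀ) * Q * J).det ≤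
          Real.exp (∑ i : Fin k, z (Fin.castLE hk i)) := by
      convert det_transpose_mul_diagonal_exp_mul_le hk (Vᵀ * Q * J) ?_ hz using 2
      · simp only [transpose_mul, transpose_transpose, Matrix.mul_assoc]
      · calc (Vᵀ * Q * J)ᵀ * (Vᵀ * Q * J) = Jᵀ * (Qᵀ * (V * Vᵀ) * Q) * J := by
              simp only [transpose_mul, transpose_transpose, Matrix.mul_assoc]
          _ = 1 := by
              rw [mul_transpose_self_of_mem_orthogonalGroup hV, Matrix.mul_one, hQQ,
                Matrix.mul_one, hJJ]
    have hlt : (Jᵀ * Qᵀ * geodesic S₀ S₁ t * Q * J).det = Real.exp (∑ i, a (e i)) := by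
      calc (Jᵀ * Qᵀ * geodesic S₀ S₁ t * Q * J).det
          = (Jᵀ * (Qᵀ * Q) * diagonal (fun i => Real.exp (a i)) * (Qᵀ * Q) * J).det := by
            rw [ha]; simp only [Matrix.mul_assoc]
        _ = _ := by
            rw [hQQ, Matrix.mul_one, Matrix.mul_one,
              transpose_submatrix_mul_diagonal_mul_submatrix _ hei, det_diagonal, Real.exp_sum]
    -- In these coordinates the compressions of `S₀`, `S₁` and the geodesic point become `Yᵀ D^s Y`
    -- with `s = 0, 1, t`.
    set Y := Xᵀ * Q * J with hY
    have key := det_transpose_mul_diagonal_rpow_mul_le Y hd ht0 ht1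
    have n0 := det_transpose_mul_diagonal_mul_nonneg Y (d := fun _ => 1) (fun _ => zero_le_one)
    have n1 := det_transpose_mul_diagonal_mul_nonneg Y (fun i => (hd i).le)
    have e0 : Yᵀ * Y = Jᵀ * Qᵀ * S₀ * Q * J := by
      rw [hX₀]; simp only [hY, transpose_mul, transpose_transpose, Matrix.mul_assoc]
    have e1 : Yᵀ * diagonal d * Y = Jᵀ * Qᵀ * S₁ * Q * J := by
      rw [hX₁]; simp only [hY, transpose_mul, transpose_transpose, Matrix.mul_assoc]
    have et : Yᵀ * diagonal (fun i => d i ^ t) * Y = Jᵀ * Qᵀ * geodesic S₀ S₁ t * Q * J := by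
      rw [hXt]; simp only [hY, transpose_mul, transpose_transpose, Matrix.mul_assoc]
    simp only [diagonal_one, Matrix.mul_one] at n0
    rw [e0] at n0
    rw [e1] at n1
    rw [e0, e1, et, hlt] at key
    have b0 := Real.rpow_le_rpow n0 (by simpa only [hS₀] using bound hV₀ hx) (sub_pos.2 ht1).le
    have b1 := Real.rpow_le_rpow n1 (by simpa only [hS₁] using bound hV₁ hy) ht0.le
    have := key.trans (mul_le_mul b0 b1 (Real.rpow_nonneg n1 _)
      (Real.rpow_nonneg (Real.exp_pos _).le _))
    rw [← Real.exp_mul, ← Real.exp_mul, ← Real.exp_add, Real.exp_le_exp] at this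
    refine this.trans_eq ?_
    simp only [Pi.add_apply, Pi.smul_apply, smul_eq_mul, Finset.sum_add_distrib,
      Finset.sum_mul]
    simp only [mul_comm]
  -- Equality of totals: the determinant is exactly log-linear along the geodesic.
  · have d0 : Real.exp (∑ i, x i) = X.det ^ 2 := by
      rw [← det_conj_diagonal_exp hV₀, ← hS₀, hX₀, det_mul, det_transpose, sq]
    have d1 : Real.exp (∑ i, y i) = X.det ^ 2 * ∏ i, d i := by
      rw [← det_conj_diagonal_exp hV₁, ← hS₁, hX₁, det_mul, det_mul, det_transpose, det_diagonal]
      ring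
    have dt : Real.exp (∑ i, a i) = X.det ^ 2 * (∏ i, d i) ^ t := by
      rw [← det_conj_diagonal_exp hQ, ← ha, hXt, det_mul, det_mul, det_transpose, det_diagonal,
        Real.finsetProd_rpow _ _ (fun i _ => (hd _).le)]
      ring
    have hprod : ∏ i, d i = Real.exp (∑ i, y i - ∑ i, x i) := by
      rw [Real.exp_sub, d1, d0, mul_div_cancel_left₀]
      rw [← d0]; exact (Real.exp_pos _).ne'
    rw [← d0, hprod, ← Real.exp_mul, ← Real.exp_add, Real.exp_eq_exp] at dt
    rw [dt]
    simp only [Pi.add_apply, Pi.smul_apply, smul_eq_mul, Finset.sum_add_distrib,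
      ← Finset.mul_sum]
    ring

/-- If the end points and an intermediate point of a geodesic have the same trace, the geodesic
is constant. -/
theorem eq_of_trace_geodesic_eq {S₀ S₁ : Matrix (Fin q) (Fin q) ℝ} (h₀ : S₀.PosDef)
    (h₁ : S₁.PosDef) {t : ℝ} (ht0 : 0 < t) (ht1 : t < 1) (h : S₁.trace = S₀.trace)
    (ht : (geodesic S₀ S₁ t).trace = S₀.trace) : S₀ = S₁ := by
  obtain ⟨X, d, hX, hd, hX₀, hX₁, hXt⟩ := exists_congruence_geodesic h₀ h₁
  have tr (e : Fin q → ℝ) : (X * diagonal e * Xᵀ).trace = ∑ i, e i * ∑ j, X j i ^ 2 := by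
    rw [trace_mul_comm, ← mul_assoc, trace]
    refine Finset.sum_congr rfl fun i _ => ?_
    rw [diag_apply, mul_diagonal, Matrix.mul_apply, mul_comm]
    simp [sq]
  have t0 : S₀.trace = ∑ i, 1 * ∑ j, X j i ^ 2 := by rw [← tr (fun _ => 1), hX₀]; simp
  have t1 : S₁.trace = ∑ i, d i * ∑ j, X j i ^ 2 := by rw [← tr d, hX₁]
  have tt : (geodesic S₀ S₁ t).trace = ∑ i, d i ^ t * ∑ j, X j i ^ 2 := by rw [← tr, hXt]
  have hc (i : Fin q) : 0 < ∑ j, X j i ^ 2 := by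
    refine lt_of_le_of_ne (Finset.sum_nonneg fun _ _ => sq_nonneg _) fun h0 => ?_
    have h0' := (Finset.sum_eq_zero_iff_of_nonneg fun _ _ => sq_nonneg _).1 h0.symm
    have : X.det = 0 := det_eq_zero_of_column_eq_zero i fun j => by simpa using h0' j
    exact ((isUnit_iff_isUnit_det X).1 hX).ne_zero this
  have hle (i : Fin q) : d i ^ t ≤ 1 + t * (d i - 1) := by
    have := rpow_one_add_le_one_add_mul_self (s := d i - 1) (by linarith [hd i]) ht0.le ht1.le
    simpa using this
  -- The trace condition makes the Bernoulli gaps, with positive weights, sum to zero; each gap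
  -- vanishes, and strict Bernoulli forces `d i = 1`.
  have hz : ∑ i, (1 + t * (d i - 1) - d i ^ t) * ∑ j, X j i ^ 2 = 0 := by
    have : ∑ i, (1 + t * (d i - 1) - d i ^ t) * ∑ j, X j i ^ 2 =
        (1 - t) * S₀.trace + t * S₁.trace - (geodesic S₀ S₁ t).trace := by
      rw [t0, t1, tt, Finset.mul_sum, Finset.mul_sum, ← Finset.sum_add_distrib,
        ← Finset.sum_sub_distrib]
      exact Finset.sum_congr rfl fun i _ => by ring
    rw [this, h, ht]; ring
  have hd1 : d = fun _ => 1 := by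
    funext i
    have hi := (Finset.sum_eq_zero_iff_of_nonneg fun i _ =>
      mul_nonneg (sub_nonneg.2 (hle i)) (hc i).le).1 hz i (Finset.mem_univ i)
    have hi' := (mul_eq_zero.1 hi).resolve_right (hc i).ne'
    by_contra hne
    have := rpow_one_add_lt_one_add_mul_self (s := d i - 1) (by linarith [hd i])
      (sub_ne_zero.2 hne) ht0 ht1
    rw [add_sub_cancel] at this
    linarith
  rw [hX₀, hX₁, hd1]
  simp

end Matrix

/-! ### Schur's theorem and its equality case -/

namespace Matrix

variable {q : ℕ}

theorem conj_diagonal_diag (V : Matrix (Fin q) (Fin q) ℝ) (x : Fin q → ℝ) (i : Fin q) :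
    (V * diagonal x * Vᵀ) i i = ∑ j, V i j ^ 2 * x j := by
  rw [Matrix.mul_apply]
  exact Finset.sum_congr rfl fun j _ => by rw [mul_diagonal, transpose_apply]; ring

/-- Schur: the diagonal of a symmetric matrix is majorized by its eigenvalues. -/
theorem diag_conj_diagonal_mem_convexHull {V : Matrix (Fin q) (Fin q) ℝ}
    (hV : V ∈ orthogonalGroup (Fin q) ℝ) (x : Fin q → ℝ) :
    diag (V * diagonal x * Vᵀ) ∈
      convexHull ℝ (Set.range fun σ : Equiv.Perm (Fin q) => x ∘ σ) := by
  -- The diagonal is the image of `x` under this matrix, and Birkhoff's theorem writes it as a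
  -- convex combination of permutation matrices.
  have hM : (of fun i j => V i j ^ 2 : Matrix (Fin q) (Fin q) ℝ) ∈ doublyStochastic ℝ (Fin q) := by
    rw [mem_doublyStochastic_iff_sum]
    refine ⟨fun i j => sq_nonneg _, fun i => ?_, fun j => ?_⟩
    · have := congrFun (congrFun (mul_transpose_self_of_mem_orthogonalGroup hV) i) i
      simpa [Matrix.mul_apply, sq] using this
    · have := congrFun (congrFun (transpose_mul_self_of_mem_orthogonalGroup hV) j) j
      simpa [Matrix.mul_apply, sq] using this
  obtain ⟨w, hw0, hw1, hw⟩ := exists_eq_sum_perm_of_mem_doublyStochastic hM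
  refine mem_convexHull_of_exists_fintype w (fun σ => x ∘ σ) hw0 hw1 (fun σ => ⟨σ, rfl⟩) ?_
  ext i
  have hi (j : Fin q) : V i j ^ 2 = ∑ σ, w σ * (σ.permMatrix ℝ) i j := by
    have := congrFun (congrFun hw i) j
    simpa [Matrix.sum_apply] using this.symm
  rw [diag_apply, conj_diagonal_diag]
  simp_rw [hi, Finset.sum_mul]
  rw [Finset.sum_comm]
  simp [Finset.sum_apply, Equiv.Perm.permMatrix, PEquiv.toMatrix_apply, Equiv.toPEquiv_apply]

/-- A symmetric matrix whose diagonal consists of its eigenvalues is diagonal. -/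
theorem conj_diagonal_eq_diagonal_of_diag_eq {V : Matrix (Fin q) (Fin q) ℝ}
    (hV : V ∈ orthogonalGroup (Fin q) ℝ) (x : Fin q → ℝ) (σ : Equiv.Perm (Fin q))
    (h : diag (V * diagonal x * Vᵀ) = x ∘ σ) :
    V * diagonal x * Vᵀ = diagonal (diag (V * diagonal x * Vᵀ)) := by
  set B := V * diagonal x * Vᵀ with hB
  have hBt : Bᵀ = B := by simp [hB, transpose_mul, Matrix.mul_assoc]
  -- The squared Frobenius norm is the sum of squared eigenvalues; the diagonal already accounts for
  -- all of it.
  have h1 : (B * B).trace = ∑ i, x i ^ 2 := by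
    calc (B * B).trace = (V * (diagonal x * (Vᵀ * V) * diagonal x * Vᵀ)).trace := by
          rw [hB]; simp only [Matrix.mul_assoc]
      _ = (diagonal x * diagonal x * (Vᵀ * V)).trace := by
          rw [trace_mul_comm, transpose_mul_self_of_mem_orthogonalGroup hV, Matrix.mul_one,
            Matrix.mul_assoc, transpose_mul_self_of_mem_orthogonalGroup hV]
      _ = _ := by
          rw [transpose_mul_self_of_mem_orthogonalGroup hV, Matrix.mul_one, diagonal_mul_diagonal,
            trace_diagonal]
          simp [sq]
  have h2 : (B * B).trace = ∑ i, ∑ j, B i j ^ 2 := by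
    conv_lhs => rw [← hBt, trace_mul_comm, hBt]
    conv_lhs => arg 1; arg 2; rw [← hBt]
    simp [trace, Matrix.mul_apply, sq]
  have h3 : ∑ i, x i ^ 2 = ∑ i, B i i ^ 2 := by
    rw [← Equiv.sum_comp σ]
    exact Finset.sum_congr rfl fun i _ => by rw [← diag_apply B i, h]; rfl
  have h4 : ∑ i, ∑ j ∈ Finset.univ.erase i, B i j ^ 2 = 0 := by
    have : ∀ i, ∑ j ∈ Finset.univ.erase i, B i j ^ 2 = ∑ j, B i j ^ 2 - B i i ^ 2 := fun i => by
      rw [← Finset.add_sum_erase _ _ (Finset.mem_univ i)]; ring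
    simp_rw [this, Finset.sum_sub_distrib]
    rw [← h2, h1, h3, sub_self]
  ext i j
  by_cases hij : i = j
  · simp [hij]
  · rw [diagonal_apply_ne _ hij]
    have h5 := (Finset.sum_eq_zero_iff_of_nonneg fun i _ =>
      Finset.sum_nonneg fun j _ => sq_nonneg (B i j)).1 h4 i (Finset.mem_univ i)
    have h6 := (Finset.sum_eq_zero_iff_of_nonneg fun j _ => sq_nonneg (B i j)).1 h5 j
      (by simp [Ne.symm hij])
    simpa using h6

end Matrix

/-! ### The correspondence between `F` and `f`, and the equivalences -/

variable {q : ℕ} {F : Matrix (Fin q) (Fin q) ℝ → ℝ} {f : (Fin q → ℝ) → ℝ}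

/-- Symmetry of `f` removes the ordering of the eigenvalues, so any orthogonal diagonalization may
be used. -/
theorem IsCorresponding.apply_conj_diagonal_exp (h : IsCorresponding F f)
    {V : Matrix (Fin q) (Fin q) ℝ} (hV : V ∈ orthogonalGroup (Fin q) ℝ) (a : Fin q → ℝ) :
    F (V * diagonal (fun i => Real.exp (a i)) * Vᵀ) = f a := by
  have hS := posDef_conj_diagonal (isUnit_of_mem_orthogonalGroup hV) (fun i => Real.exp_pos (a i))
  obtain ⟨W, hW, hWS⟩ := hS.isHermitian.exists_orthogonal_conj_orderedEigenvalues
  obtain ⟨σ, hσ⟩ := exists_perm_of_conj_diagonal_eq hW hV hWS.symm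
  rw [h.2 _ hS, hσ, ← h.1 σ a]
  congr 1
  ext i
  simp

theorem IsCorresponding.apply_diagonal_exp (h : IsCorresponding F f) (a : Fin q → ℝ) :
    F (diagonal fun i => Real.exp (a i)) = f a := by
  simpa using h.apply_conj_diagonal_exp (one_mem (orthogonalGroup (Fin q) ℝ)) a

/-- Invariance under permutation matrices gives the symmetry of `f`; invariance under an eigenvector
matrix gives the formula for `F`. -/
theorem isCorresponding_of_orthogonallyInvariant (hF : OrthogonallyInvariant F) :
    IsCorresponding F fun a => F (diagonal fun i => Real.exp (a i)) := by
  refine ⟨fun σ a => ?_, fun S hS => ?_⟩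
  · beta_reduce
    rw [← hF _ (PosDef.diagonal fun i => Real.exp_pos (a i)) _ (submatrix_one_perm_mem_orthogonalGroup σ),
      conj_diagonal_perm]
    rfl
  · obtain ⟨V, hV, h⟩ := hS.isHermitian.exists_orthogonal_conj_orderedEigenvalues
    simp_rw [Real.exp_log (orderedEigenvalues_pos hS _)]
    conv_lhs => rw [h]
    exact hF _ (PosDef.diagonal fun i => orderedEigenvalues_pos hS i) _ hV

theorem geodesic_diagonal_exp (x y : Fin q → ℝ) (t : ℝ) :
    geodesic (diagonal fun i => Real.exp (x i)) (diagonal fun i => Real.exp (y i)) t =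
      diagonal fun i => Real.exp (((1 - t) • x + t • y) i) := by
  have hp (d : Fin q → ℝ) (s : ℝ) : symmPow (diagonal d) s = diagonal fun i => d i ^ s := by
    simpa [symmPow] using cfc_conj_diagonal (one_mem (orthogonalGroup (Fin q) ℝ)) d (fun x => x ^ s)
  simp only [geodesic, hp, diagonal_mul_diagonal]
  congr 1
  ext i
  simp only [← Real.exp_mul, ← Real.exp_add, Pi.add_apply, Pi.smul_apply, smul_eq_mul]
  congr 1
  ring

theorem exp_diagonal_real (x : Fin q → ℝ) :
    NormedSpace.exp (diagonal x) = diagonal fun i => Real.exp (x i) := by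
  simpa using exp_conj_diagonal (one_mem (orthogonalGroup (Fin q) ℝ)) x

theorem posDef_diagonal_exp (x : Fin q → ℝ) : (diagonal fun i => Real.exp (x i)).PosDef :=
  PosDef.diagonal fun i => Real.exp_pos (x i)

theorem posDef_geodesic {S₀ S₁ : Matrix (Fin q) (Fin q) ℝ} (h₀ : S₀.PosDef) (h₁ : S₁.PosDef)
    (t : ℝ) : (geodesic S₀ S₁ t).PosDef := by
  obtain ⟨X, d, hX, hd, -, -, hXt⟩ := exists_congruence_geodesic h₀ h₁
  rw [hXt]
  exact posDef_conj_diagonal hX fun i => Real.rpow_pos_of_pos (hd i) t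

theorem convex_setOf_isSymm : Convex ℝ {A : Matrix (Fin q) (Fin q) ℝ | A.IsSymm} :=
  fun _ hA _ hB a b _ _ _ => (IsSymm.smul hA a).add (IsSymm.smul hB b)

namespace IsCorresponding

theorem convexOn_of_gConvex (h : IsCorresponding F f) (hF : GConvex F) :
    ConvexOn ℝ Set.univ f := by
  -- `GConvex` speaks only of `0 < t < 1`, so the weights must be positive.
  refine convexOn_iff_forall_pos.2 ⟨convex_univ, fun x _ y _ a b ha hb hab => ?_⟩
  obtain rfl : a = 1 - b := by linarith
  have := hF _ _ (posDef_diagonal_exp x) (posDef_diagonal_exp y) b hb (by linarith)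
  rwa [geodesic_diagonal_exp, h.apply_diagonal_exp, h.apply_diagonal_exp,
    h.apply_diagonal_exp] at this

theorem strictConvexOn_of_strictGConvex (h : IsCorresponding F f) (hF : StrictGConvex F) :
    StrictConvexOn ℝ Set.univ f := by
  refine ⟨convex_univ, fun x _ y _ hxy a b ha hb hab => ?_⟩
  obtain rfl : a = 1 - b := by linarith
  have hne : (diagonal fun i => Real.exp (x i)) ≠ diagonal fun i => Real.exp (y i) := fun he =>
    hxy (funext fun i => Real.exp_injective (congrFun (diagonal_injective he) i))
  have := hF _ _ (posDef_diagonal_exp x) (posDef_diagonal_exp y) hne b hb (by linarith)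
  rwa [geodesic_diagonal_exp, h.apply_diagonal_exp, h.apply_diagonal_exp,
    h.apply_diagonal_exp] at this

theorem convexOn_of_convexInLog (h : IsCorresponding F f) (hF : ConvexInLog F) :
    ConvexOn ℝ Set.univ f := by
  refine ⟨convex_univ, fun x _ y _ a b ha hb hab => ?_⟩
  have := hF.2 (isSymm_diagonal x) (isSymm_diagonal y) ha hb hab
  simpa only [← diagonal_smul, diagonal_add, exp_diagonal_real, h.apply_diagonal_exp] using! this

theorem strictConvexOn_of_strictConvexInLog (h : IsCorresponding F f)
    (hF : StrictConvexInLog F) : StrictConvexOn ℝ Set.univ f := by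
  refine ⟨convex_univ, fun x _ y _ hxy a b ha hb hab => ?_⟩
  have := hF.2 (isSymm_diagonal x) (isSymm_diagonal y) (diagonal_injective.ne hxy) ha hb hab
  simpa only [← diagonal_smul, diagonal_add, exp_diagonal_real, h.apply_diagonal_exp] using! this

theorem gConvex_of_convexOn (h : IsCorresponding F f) (hf : ConvexOn ℝ Set.univ f) :
    GConvex F := by
  intro S₀ S₁ h₀ h₁ t ht0 ht1
  obtain ⟨V₀, hV₀, x, hx, hS₀⟩ := h₀.exists_orthogonal_conj_exp
  obtain ⟨V₁, hV₁, y, hy, hS₁⟩ := h₁.exists_orthogonal_conj_exp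
  obtain ⟨Q, hQ, a, -, ha⟩ := (posDef_geodesic h₀ h₁ t).exists_orthogonal_conj_exp
  have hmem := log_eigenvalues_geodesic_mem_convexHull hV₀ hV₁ hQ hx hy h₀ h₁ hS₀ hS₁ ht0 ht1 ha
  rw [ha, hS₀, hS₁, h.apply_conj_diagonal_exp hQ, h.apply_conj_diagonal_exp hV₀,
    h.apply_conj_diagonal_exp hV₁]
  exact (hf.le_of_mem_convexHull_perm h.1 hmem).trans
    (hf.2 trivial trivial (sub_pos.2 ht1).le ht0.le (by ring))

theorem strictGConvex_of_strictConvexOn (h : IsCorresponding F f)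
    (hf : StrictConvexOn ℝ Set.univ f) : StrictGConvex F := by
  intro S₀ S₁ h₀ h₁ hne t ht0 ht1
  obtain ⟨V₀, hV₀, x, hx, hS₀⟩ := h₀.exists_orthogonal_conj_exp
  obtain ⟨V₁, hV₁, y, hy, hS₁⟩ := h₁.exists_orthogonal_conj_exp
  obtain ⟨Q, hQ, a, -, ha⟩ := (posDef_geodesic h₀ h₁ t).exists_orthogonal_conj_exp
  have hmem := log_eigenvalues_geodesic_mem_convexHull hV₀ hV₁ hQ hx hy h₀ h₁ hS₀ hS₁ ht0 ht1 ha
  have e₀ : F S₀ = f x := by rw [hS₀, h.apply_conj_diagonal_exp hV₀]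
  have e₁ : F S₁ = f y := by rw [hS₁, h.apply_conj_diagonal_exp hV₁]
  rw [ha, e₀, e₁, h.apply_conj_diagonal_exp hQ]
  -- Different spectra: strict convexity of `f` suffices. Equal spectra: either majorization is
  -- strict, or the geodesic point has the same spectrum too, hence the same trace, and `S₀ = S₁`.
  by_cases hxy : x = y
  · subst hxy
    have hb : (1 - t) • x + t • x = x := by rw [← add_smul]; simp
    rw [hb] at hmem
    have hlt := hf.lt_of_mem_convexHull_perm h.1 hmem fun σ hσ => hne ?_
    · linarith
    · have tr {V : Matrix (Fin q) (Fin q) ℝ} (hV : V ∈ orthogonalGroup (Fin q) ℝ)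
          (d : Fin q → ℝ) : (V * diagonal d * Vᵀ).trace = ∑ i, d i := by
        rw [trace_mul_comm, ← Matrix.mul_assoc, transpose_mul_self_of_mem_orthogonalGroup hV,
          Matrix.one_mul, trace_diagonal]
      refine eq_of_trace_geodesic_eq h₀ h₁ ht0 ht1 ?_ ?_
      · rw [hS₀, hS₁, tr hV₀, tr hV₁]
      · rw [ha, hS₀, tr hV₀, tr hQ, hσ]
        exact Equiv.sum_comp σ fun i => Real.exp (x i)
  · exact (hf.convexOn.le_of_mem_convexHull_perm h.1 hmem).trans_lt
      (hf.2 trivial trivial hxy (sub_pos.2 ht1) ht0 (by ring))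

theorem apply_exp_conj_diagonal (h : IsCorresponding F f)
    {V : Matrix (Fin q) (Fin q) ℝ} (hV : V ∈ orthogonalGroup (Fin q) ℝ) (a : Fin q → ℝ) :
    F (NormedSpace.exp (V * diagonal a * Vᵀ)) = f a := by
  rw [exp_conj_diagonal hV, h.apply_conj_diagonal_exp hV]

end IsCorresponding

/-- In an eigenbasis of a convex combination of two symmetric matrices, the eigenvalues of the
combination are the combination of the diagonals. -/
theorem exists_simultaneous_frame {A B : Matrix (Fin q) (Fin q) ℝ} (hA : A.IsSymm) (hB : B.IsSymm)
    (s t : ℝ) :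
    ∃ Q ∈ orthogonalGroup (Fin q) ℝ, ∃ V ∈ orthogonalGroup (Fin q) ℝ,
      ∃ W ∈ orthogonalGroup (Fin q) ℝ, ∃ x y : Fin q → ℝ,
        A = (Q * V) * diagonal x * (Q * V)ᵀ ∧ B = (Q * W) * diagonal y * (Q * W)ᵀ ∧
        s • A + t • B = Q * diagonal (s • diag (V * diagonal x * Vᵀ) +
          t • diag (W * diagonal y * Wᵀ)) * Qᵀ := by
  have hC : (s • A + t • B).IsHermitian := (hA.smul s).add (hB.smul t)
  obtain ⟨Q, hQ, hQC⟩ := hC.exists_orthogonal_conj_eigenvalues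
  obtain ⟨V, hV, hVA⟩ := IsHermitian.exists_orthogonal_conj_eigenvalues (S := A) hA
  obtain ⟨W, hW, hWB⟩ := IsHermitian.exists_orthogonal_conj_eigenvalues (S := B) hB
  set x := IsHermitian.eigenvalues (A := A) hA
  set y := IsHermitian.eigenvalues (A := B) hB
  set c := hC.eigenvalues
  have e1 := transpose_mul_self_of_mem_orthogonalGroup hQ
  have e2 := mul_transpose_self_of_mem_orthogonalGroup hQ
  have hcancel (V : Matrix (Fin q) (Fin q) ℝ) : Q * (Qᵀ * V) = V := by
    rw [← Matrix.mul_assoc, e2, Matrix.one_mul]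
  refine ⟨Q, hQ, Qᵀ * V, mul_mem (transpose_mem_orthogonalGroup hQ) hV, Qᵀ * W,
    mul_mem (transpose_mem_orthogonalGroup hQ) hW, x, y, by rwa [hcancel], by rwa [hcancel], ?_⟩
  -- The combination is diagonal in the basis `Q`, so its eigenvalues are read off by taking
  -- diagonals of both terms.
  have hdiag : diagonal c = s • (Qᵀ * A * Q) + t • (Qᵀ * B * Q) := by
    calc diagonal c = (Qᵀ * Q) * diagonal c * (Qᵀ * Q) := by
          rw [e1, Matrix.one_mul, Matrix.mul_one]
      _ = Qᵀ * (s • A + t • B) * Q := by rw [hQC]; simp only [Matrix.mul_assoc]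
      _ = _ := by simp [Matrix.mul_add, Matrix.add_mul]
  have hx : Qᵀ * V * diagonal x * (Qᵀ * V)ᵀ = Qᵀ * A * Q := by
    conv_rhs => rw [hVA]
    simp only [transpose_mul, transpose_transpose, Matrix.mul_assoc]
  have hy : Qᵀ * W * diagonal y * (Qᵀ * W)ᵀ = Qᵀ * B * Q := by
    conv_rhs => rw [hWB]
    simp only [transpose_mul, transpose_transpose, Matrix.mul_assoc]
  have hc : c = s • diag (Qᵀ * A * Q) + t • diag (Qᵀ * B * Q) := by
    rw [← diag_smul, ← diag_smul, ← diag_add, ← hdiag, diag_diagonal]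
  rw [hx, hy, ← hc]
  exact hQC

namespace IsCorresponding

theorem convexInLog_of_convexOn (h : IsCorresponding F f) (hf : ConvexOn ℝ Set.univ f) :
    ConvexInLog F := by
  refine ⟨convex_setOf_isSymm, fun A hA B hB s t hs ht hst => ?_⟩
  obtain ⟨Q, hQ, V, hV, W, hW, x, y, hx, hy, hc⟩ := exists_simultaneous_frame hA hB s t
  have eA : F (NormedSpace.exp A) = f x := by rw [hx, h.apply_exp_conj_diagonal (mul_mem hQ hV)]
  have eB : F (NormedSpace.exp B) = f y := by rw [hy, h.apply_exp_conj_diagonal (mul_mem hQ hW)]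
  simp only [hc, eA, eB, h.apply_exp_conj_diagonal hQ]
  have lx := hf.le_of_mem_convexHull_perm h.1 (diag_conj_diagonal_mem_convexHull hV x)
  have ly := hf.le_of_mem_convexHull_perm h.1 (diag_conj_diagonal_mem_convexHull hW y)
  refine (hf.2 trivial trivial hs ht hst).trans ?_
  simp only [smul_eq_mul]
  gcongr

theorem strictConvexInLog_of_strictConvexOn (h : IsCorresponding F f)
    (hf : StrictConvexOn ℝ Set.univ f) : StrictConvexInLog F := by
  refine ⟨convex_setOf_isSymm, fun A hA B hB hAB s t hs ht hst => ?_⟩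
  obtain ⟨Q, hQ, V, hV, W, hW, x, y, hx, hy, hc⟩ := exists_simultaneous_frame hA hB s t
  have eA : F (NormedSpace.exp A) = f x := by rw [hx, h.apply_exp_conj_diagonal (mul_mem hQ hV)]
  have eB : F (NormedSpace.exp B) = f y := by rw [hy, h.apply_exp_conj_diagonal (mul_mem hQ hW)]
  simp only [hc, eA, eB, h.apply_exp_conj_diagonal hQ]
  have mx := diag_conj_diagonal_mem_convexHull hV x
  have my := diag_conj_diagonal_mem_convexHull hW y
  have lx := hf.convexOn.le_of_mem_convexHull_perm h.1 mx
  have ly := hf.convexOn.le_of_mem_convexHull_perm h.1 my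
  simp only [smul_eq_mul]
  -- If the diagonals agree, strictness must come from a Schur step. It fails only when both
  -- diagonals are rearranged spectra; then both matrices are diagonal in the basis `Q`, and `A =
  -- B`.
  by_cases hd : diag (V * diagonal x * Vᵀ) = diag (W * diagonal y * Wᵀ)
  · have hcd := hf.convexOn.2 (x := diag (V * diagonal x * Vᵀ)) trivial
      (y := diag (W * diagonal y * Wᵀ)) trivial hs.le ht.le hst
    simp only [smul_eq_mul] at hcd
    by_cases h1 : ∃ σ : Equiv.Perm (Fin q), diag (V * diagonal x * Vᵀ) = x ∘ σ
    · by_cases h2 : ∃ σ : Equiv.Perm (Fin q), diag (W * diagonal y * Wᵀ) = y ∘ σ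
      · obtain ⟨σ, h1⟩ := h1
        obtain ⟨τ, h2⟩ := h2
        refine absurd ?_ hAB
        have e1 := conj_diagonal_eq_diagonal_of_diag_eq hV x σ h1
        have e2 := conj_diagonal_eq_diagonal_of_diag_eq hW y τ h2
        have e3 : V * diagonal x * Vᵀ = W * diagonal y * Wᵀ := by rw [e1, e2, hd]
        calc A = Q * (V * diagonal x * Vᵀ) * Qᵀ := by
              rw [hx]; simp only [transpose_mul, Matrix.mul_assoc]
          _ = B := by rw [e3, hy]; simp only [transpose_mul, Matrix.mul_assoc]
      · push Not at h2
        have := mul_lt_mul_of_pos_left (hf.lt_of_mem_convexHull_perm h.1 my h2) ht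
        have := mul_le_mul_of_nonneg_left lx hs.le
        linarith
    · push Not at h1
      have := mul_lt_mul_of_pos_left (hf.lt_of_mem_convexHull_perm h.1 mx h1) hs
      have := mul_le_mul_of_nonneg_left ly ht.le
      linarith
  · refine (hf.2 trivial trivial hd hs ht hst).trans_le ?_
    simp only [smul_eq_mul]
    gcongr

end IsCorresponding
theorem theorem1 (q : ℕ) (F : Matrix (Fin q) (Fin q) ℝ → ℝ) (hF : OrthogonallyInvariant F) :
    (∃! f : (Fin q → ℝ) → ℝ, IsCorresponding F f) ∧
      ∀ f : (Fin q → ℝ) → ℝ, IsCorresponding F f →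
        [GConvex F, ConvexInLog F, ConvexOn ℝ Set.univ f].TFAE ∧
        [StrictGConvex F, StrictConvexInLog F, StrictConvexOn ℝ Set.univ f].TFAE := by
  refine ⟨⟨_, isCorresponding_of_orthogonallyInvariant hF, fun f hf =>
    funext fun a => (hf.apply_diagonal_exp a).symm⟩, fun f hf => ⟨?_, ?_⟩⟩
  · tfae_have 1 → 3 := hf.convexOn_of_gConvex
    tfae_have 2 → 3 := hf.convexOn_of_convexInLog
    tfae_have 3 → 1 := hf.gConvex_of_convexOn
    tfae_have 3 → 2 := hf.convexInLog_of_convexOn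
    tfae_finish
  · tfae_have 1 → 3 := hf.strictConvexOn_of_strictGConvex
    tfae_have 2 → 3 := hf.strictConvexOn_of_strictConvexInLog
    tfae_have 3 → 1 := hf.strictGConvex_of_strictConvexOn
    tfae_have 3 → 2 := hf.strictConvexInLog_of_strictConvexOn
    tfae_finish
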